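/- **Theorem B ($G$-singular Legendrian bordism groups).** Let $W$ be a smooth $(2n+1)$-dimensional manifold with a contact structure, i.e. a smooth $1$-form $\chi$ with $\chi\wedge(d\chi)^n\neq 0$ at every point. Let $\pi:J^1_n(W)\to W$ be the manifold of $1$-jets of $n$-dimensional submanifolds of $W$ (its points are the pairs $(a,L)$ with $a\in W$ and $L\subset T_aW$ an $n$-dimensional subspace), with its Cartan distribution $\mathbf{E}\subset TJ^1_n(W)$, spanned by the tangent spaces of the prolongations $N^{(1)}=\{(a,T_aN)\mid a\in N\}$ of $n$-dimensional submanifolds $N\subset W$, and let $$\mathcal{L}eg=\{(a,L)\in J^1_n(W)\mid \chi_a|_L=0\}$$ be the first order equation of the Legendrian submanifolds of $W$. Let $G$ be an abelian group, regarded as a module over a ring $R$ (for instance $R=\mathbb{Z}$, or $R=G$ if $G$ is a ring). Let $\bar C_p=\bar C_p(\mathcal{L}eg;G)$, $p\ge 0$, be the $R$-module of formal finite linear combinations with coefficients in $G$ of maps $f:\Delta^p\to\mathcal{L}eg$ that extend to a smooth map into $\mathcal{L}eg$ of a neighbourhood of $\Delta^p$ in $\mathbb{R}^{p+1}$ and satisfy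 $Tf(T\Delta^p)\subset\mathbf{E}$. With the usual singular boundary operator $\bar\partial$ this is a chain complex; let $\bar H_p(\mathcal{L}eg;G)$ be its homology, $\bar Z_p=\ker\bar\partial\subset\bar C_p$ and $\bar B_p=\bar\partial(\bar C_{p+1})$. Put - $\overline{Bor}_p(\mathcal{L}eg;G)$: the group of $p$-chains modulo the relation $a\sim b$ iff $a-b=\bar\partial c$ for some $c\in\bar C_{p+1}$; - $\overline{Cyc}_p(\mathcal{L}eg;G)$: the group of $p$-chains modulo the relation $a\sim b$ iff $\bar\partial(a-b)=0$; - ${}^G\Omega^{\mathcal{L}eg}_{p,s}$: the group of closed $p$-chains ($\bar\partial a=0$) modulo the relation $a\sim b$ iff $a-b=\bar\partial c$ for some $c\in\bar C_{p+1}$. For $p=n-1$ this is the $G$-singular bordism group of compact $(n-1)$-dimensional submanifolds bording by means of $n$-dimensional Legendrian submanifolds of $W$. Then, for every $p\ge 0$: 1. There is a canonical isomorphism ${}^G\Omega^{\mathcal{L}eg}_{p,s}\cong\bar H_p(\mathcal{L}eg;G)$, which sends the class of a closed chain to its homology class. 2. If ${}^G\Omega^{\mathcal{L}eg}_{p,s}=0$,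 then the canonical projection is an isomorphism $\overline{Bor}_p(\mathcal{L}eg;G)\cong\overline{Cyc}_p(\mathcal{L}eg;G)$. 3. If $\overline{Cyc}_p(\mathcal{L}eg;G)$ is a free $R$-module, then the sequence $0\to{}^G\Omega^{\mathcal{L}eg}_{p,s}\to\overline{Bor}_p(\mathcal{L}eg;G)\to\overline{Cyc}_p(\mathcal{L}eg;G)\to 0$ splits, and $$\overline{Bor}_p(\mathcal{L}eg;G)\cong{}^G\Omega^{\mathcal{L}eg}_{p,s}\oplus\overline{Cyc}_p(\mathcal{L}eg;G).$$ All isomorphisms are $R$-linear. -/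

import Mathlib

open scoped Manifold ContDiff Simplicial
open CategoryTheory

noncomputable section

namespace LegBordism

/-- The model space `ℝ^{2n+1}` of the contact manifold. -/
abbrev BaseModel (n : ℕ) : Type := EuclideanSpace ℝ (Fin (2 * n + 1))

/-- The space `ℝ^n` of the independent coordinates `x^α`. -/
abbrev XSpace (n : ℕ) : Type := EuclideanSpace ℝ (Fin n)

/-- The space `ℝ^{n+1}` of the dependent coordinates. -/
abbrev YSpace (n : ℕ) : Type := EuclideanSpace ℝ (Fin (n + 1))

/-- The model space of `J¹_n(W)`: a point of `ℝ^{2n+1}` together with the matrix of first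
derivatives of the dependent coordinates with respect to the independent ones. -/
abbrev JetModel (n : ℕ) : Type := BaseModel n × (XSpace n →L[ℝ] YSpace n)

/-- A point of `J¹_n(W)`. The `1`-jet at `a` of an `n`-dimensional submanifold `N` of `W` is its
tangent space `T_a N`, an `n`-dimensional subspace of `T_a W`; every such subspace occurs. -/
structure Jet1 (n : ℕ) (W : Type*) [TopologicalSpace W] [ChartedSpace (BaseModel n) W] where
  /-- the projection to `W` -/
  base : W
  /-- the tangent plane -/
  plane : Submodule ℝ (TangentSpace 𝓘(ℝ, BaseModel n) base)
  finrank_plane : Module.finrank ℝ plane = n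

section Charts

variable {n : ℕ} {W : Type*} [TopologicalSpace W] [ChartedSpace (BaseModel n) W]
  [IsManifold 𝓘(ℝ, BaseModel n) ∞ W]

open Classical in
/-- The differential at `a` of a chart `φ` of `W` whose domain contains `a`
(and an irrelevant value otherwise). -/
def chartDeriv (φ : OpenPartialHomeomorph W (BaseModel n)) (a : W) :
    TangentSpace 𝓘(ℝ, BaseModel n) a ≃L[ℝ] BaseModel n :=
  if h : φ ∈ atlas (BaseModel n) W ∧ a ∈ φ.source then
    (mdifferentiable_of_mem_atlas (I := 𝓘(ℝ, BaseModel n)) h.1).mfderiv h.2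
  else ContinuousLinearEquiv.refl ℝ (BaseModel n)

theorem chartDeriv_eq {φ : OpenPartialHomeomorph W (BaseModel n)}
    (hφ : φ ∈ atlas (BaseModel n) W) {a : W} (ha : a ∈ φ.source) :
    chartDeriv φ a =
      (mdifferentiable_of_mem_atlas (I := 𝓘(ℝ, BaseModel n)) hφ).mfderiv ha :=
  dif_pos ⟨hφ, ha⟩

/-- `T_a W` in the coordinates given by a chart `φ` of `W` and a linear splitting `Φ` of
`ℝ^{2n+1}` into independent and dependent coordinates. -/
def splitDeriv (φ : OpenPartialHomeomorph W (BaseModel n))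
    (Φ : BaseModel n ≃L[ℝ] XSpace n × YSpace n) (a : W) :
    TangentSpace 𝓘(ℝ, BaseModel n) a ≃L[ℝ] XSpace n × YSpace n :=
  (chartDeriv φ a).trans Φ

/-- The jet at `a` whose plane is, in the given coordinates, the graph of `A`. -/
def jetOfGraph (φ : OpenPartialHomeomorph W (BaseModel n))
    (Φ : BaseModel n ≃L[ℝ] XSpace n × YSpace n) (a : W) (A : XSpace n →L[ℝ] YSpace n) :
    Jet1 n W where
  base := a
  plane := (A : XSpace n →ₗ[ℝ] YSpace n).graph.comap
    ((splitDeriv φ Φ a).toLinearEquiv : TangentSpace 𝓘(ℝ, BaseModel n) a →ₗ[ℝ] _)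
  finrank_plane := by
    rw [Submodule.comap_equiv_eq_map_symm, LinearEquiv.finrank_map_eq,
      LinearMap.graph_eq_range_prod, LinearMap.finrank_range_of_inj, finrank_euclideanSpace_fin]
    intro x y h
    exact congrArg Prod.fst h

/-- `q` lies over the domain of `φ` and its plane is the graph of `A`. -/
def IsGraphAt (φ : OpenPartialHomeomorph W (BaseModel n))
    (Φ : BaseModel n ≃L[ℝ] XSpace n × YSpace n) (q : Jet1 n W)
    (A : XSpace n →L[ℝ] YSpace n) : Prop :=
  q.plane.map ((splitDeriv φ Φ q.base).toLinearEquiv :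
    TangentSpace 𝓘(ℝ, BaseModel n) q.base →ₗ[ℝ] _) = (A : XSpace n →ₗ[ℝ] YSpace n).graph

theorem graph_injective {A B : XSpace n →L[ℝ] YSpace n}
    (h : (A : XSpace n →ₗ[ℝ] YSpace n).graph = (B : XSpace n →ₗ[ℝ] YSpace n).graph) : A = B := by
  ext1 x
  have : (x, A x) ∈ (B : XSpace n →ₗ[ℝ] YSpace n).graph := by
    rw [← h, LinearMap.mem_graph_iff]; rfl
  exact (LinearMap.mem_graph_iff _ _).1 this

theorem isGraphAt_jetOfGraph (φ : OpenPartialHomeomorph W (BaseModel n))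
    (Φ : BaseModel n ≃L[ℝ] XSpace n × YSpace n) (a : W) (A : XSpace n →L[ℝ] YSpace n) :
    IsGraphAt φ Φ (jetOfGraph φ Φ a A) A :=
  Submodule.map_comap_eq_of_surjective (splitDeriv φ Φ a).toLinearEquiv.surjective _

theorem jetOfGraph_eq {φ : OpenPartialHomeomorph W (BaseModel n)}
    {Φ : BaseModel n ≃L[ℝ] XSpace n × YSpace n} {q : Jet1 n W} {A : XSpace n →L[ℝ] YSpace n}
    (h : IsGraphAt φ Φ q A) : jetOfGraph φ Φ q.base A = q := by
  obtain ⟨a, P, hP⟩ := q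
  simp only [jetOfGraph, Jet1.mk.injEq, true_and]
  rw [← h]
  exact Submodule.comap_map_eq_of_injective (splitDeriv φ Φ a).toLinearEquiv.injective _

open Classical in
/-- The local coordinates `(x^α, y^j, y^j_α)` on `J¹_n(W)` given by a chart of `W` and a splitting
of its coordinates into independent and dependent ones. -/
def jetChart (φ : OpenPartialHomeomorph W (BaseModel n))
    (Φ : BaseModel n ≃L[ℝ] XSpace n × YSpace n) : PartialEquiv (Jet1 n W) (JetModel n) where
  toFun q := (φ q.base, if h : ∃ A, IsGraphAt φ Φ q A then h.choose else 0)
  invFun z := jetOfGraph φ Φ (φ.symm z.1) z.2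
  source := {q | q.base ∈ φ.source ∧ ∃ A, IsGraphAt φ Φ q A}
  target := φ.target ×ˢ Set.univ
  map_source' q hq := ⟨φ.map_source hq.1, trivial⟩
  map_target' z hz := ⟨φ.map_target hz.1, z.2, isGraphAt_jetOfGraph _ _ _ _⟩
  left_inv' q hq := by
    dsimp only
    rw [φ.left_inv hq.1, dif_pos hq.2]
    exact jetOfGraph_eq hq.2.choose_spec
  right_inv' z hz := by
    have h : ∃ A, IsGraphAt φ Φ (jetOfGraph φ Φ (φ.symm z.1) z.2) A :=
      ⟨z.2, isGraphAt_jetOfGraph _ _ _ _⟩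
    refine Prod.ext (φ.right_inv hz.1) ?_
    dsimp only
    rw [dif_pos h]
    exact graph_injective (h.choose_spec.symm.trans (isGraphAt_jetOfGraph _ _ _ _))

open Classical in
theorem jetChart_snd {φ : OpenPartialHomeomorph W (BaseModel n)}
    {Φ : BaseModel n ≃L[ℝ] XSpace n × YSpace n} {q : Jet1 n W} {A : XSpace n →L[ℝ] YSpace n}
    (h : IsGraphAt φ Φ q A) : (jetChart φ Φ q).2 = A := by
  have h' : ∃ A, IsGraphAt φ Φ q A := ⟨A, h⟩
  change (if h : ∃ A, IsGraphAt φ Φ q A then h.choose else 0) = A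
  rw [dif_pos h']
  exact graph_injective (h'.choose_spec.symm.trans h)

/-- For a linear automorphism `T` of `ℝ^n × ℝ^{n+1}`, the image of the graph of `A` is a graph iff
its projection to `ℝ^n` is invertible. -/
theorem map_graph_iff (T : (XSpace n × YSpace n) ≃L[ℝ] XSpace n × YSpace n)
    (A B : XSpace n →L[ℝ] YSpace n) :
    (A : XSpace n →ₗ[ℝ] YSpace n).graph.map (T.toLinearEquiv : _ →ₗ[ℝ] XSpace n × YSpace n) =
        (B : XSpace n →ₗ[ℝ] YSpace n).graph ↔
      ((ContinuousLinearMap.fst ℝ _ _).comp ((T : _ →L[ℝ] XSpace n × YSpace n).comp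
        ((ContinuousLinearMap.id ℝ _).prod A))).IsInvertible ∧
      B = ((ContinuousLinearMap.snd ℝ _ _).comp ((T : _ →L[ℝ] XSpace n × YSpace n).comp
        ((ContinuousLinearMap.id ℝ _).prod A))).comp
        ((ContinuousLinearMap.fst ℝ _ _).comp ((T : _ →L[ℝ] XSpace n × YSpace n).comp
        ((ContinuousLinearMap.id ℝ _).prod A))).inverse := by
  set P : XSpace n →L[ℝ] XSpace n × YSpace n :=
    (T : _ →L[ℝ] XSpace n × YSpace n).comp ((ContinuousLinearMap.id ℝ _).prod A) with hP
  have hmem : ∀ z, z ∈ (A : XSpace n →ₗ[ℝ] YSpace n).graph.map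
      (T.toLinearEquiv : _ →ₗ[ℝ] XSpace n × YSpace n) ↔ ∃ u, P u = z := by
    intro z
    constructor
    · rintro ⟨⟨u, w⟩, hu, rfl⟩
      have : w = A u := (LinearMap.mem_graph_iff _ _).1 hu
      subst this
      exact ⟨u, rfl⟩
    · rintro ⟨u, rfl⟩
      exact ⟨(u, A u), (LinearMap.mem_graph_iff _ _).2 rfl, rfl⟩
  have hPinj : ∀ u, P u = 0 → u = 0 := by
    intro u hu
    have : (u, A u) = 0 := T.injective (by simpa [hP] using hu)
    exact congrArg Prod.fst this
  constructor
  · intro h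
    have hB : ∀ u, (P u).2 = B (P u).1 := fun u => by
      have : P u ∈ (B : XSpace n →ₗ[ℝ] YSpace n).graph := by rw [← h, hmem]; exact ⟨u, rfl⟩
      exact (LinearMap.mem_graph_iff _ _).1 this
    have hinv : ((ContinuousLinearMap.fst ℝ _ _).comp P).IsInvertible := by
      have hbij : Function.Bijective ((ContinuousLinearMap.fst ℝ _ _).comp P).toLinearMap := by
        constructor
        · rw [← LinearMap.ker_eq_bot, LinearMap.ker_eq_bot']
          intro u hu
          have h1 : (P u).1 = 0 := hu
          exact hPinj u (Prod.ext h1 (by rw [hB, h1]; simp))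
        · intro x
          have : ((x, B x) : XSpace n × YSpace n) ∈ (B : XSpace n →ₗ[ℝ] YSpace n).graph :=
            (LinearMap.mem_graph_iff _ _).2 rfl
          rw [← h, hmem] at this
          obtain ⟨u, hu⟩ := this
          exact ⟨u, congrArg Prod.fst hu⟩
      exact ⟨(LinearEquiv.ofBijective _ hbij).toContinuousLinearEquiv, by ext; rfl⟩
    refine ⟨hinv, ?_⟩
    ext1 x
    have := hB (((ContinuousLinearMap.fst ℝ _ _).comp P).inverse x)
    have h2 := hinv.self_apply_inverse x
    rw [ContinuousLinearMap.comp_apply, ContinuousLinearMap.coe_fst'] at h2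
    rw [h2] at this
    exact this.symm
  · rintro ⟨hinv, rfl⟩
    ext z
    rw [hmem, LinearMap.mem_graph_iff]
    constructor
    · rintro ⟨u, rfl⟩
      have := hinv.inverse_apply_self u
      change (P u).2 = (P (((ContinuousLinearMap.fst ℝ _ _).comp P).inverse (P u).1)).2
      rw [ContinuousLinearMap.comp_apply, ContinuousLinearMap.coe_fst'] at this
      rw [this]
    · intro hz
      refine ⟨((ContinuousLinearMap.fst ℝ _ _).comp P).inverse z.1, Prod.ext ?_ hz.symm⟩
      exact hinv.self_apply_inverse z.1

/-- The linear part of a change of coordinates. -/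
def transLin (φ φ' : OpenPartialHomeomorph W (BaseModel n))
    (Φ Φ' : BaseModel n ≃L[ℝ] XSpace n × YSpace n) (x : BaseModel n) :
    (XSpace n × YSpace n) →L[ℝ] XSpace n × YSpace n :=
  (Φ' : _ →L[ℝ] XSpace n × YSpace n).comp
    ((fderiv ℝ (φ' ∘ φ.symm) x).comp (Φ.symm : _ →L[ℝ] BaseModel n))

theorem transLin_eq {φ φ' : OpenPartialHomeomorph W (BaseModel n)}
    (hφ : φ ∈ atlas (BaseModel n) W) (hφ' : φ' ∈ atlas (BaseModel n) W)
    (Φ Φ' : BaseModel n ≃L[ℝ] XSpace n × YSpace n) {x : BaseModel n}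
    (hx : x ∈ φ.target) (hx' : φ.symm x ∈ φ'.source) :
    ((((splitDeriv φ Φ (φ.symm x)).symm.trans (splitDeriv φ' Φ' (φ.symm x)) :
      (XSpace n × YSpace n) ≃L[ℝ] XSpace n × YSpace n)) :
      (XSpace n × YSpace n) →L[ℝ] XSpace n × YSpace n) = transLin φ φ' Φ Φ' x := by
  have e1 := mdifferentiable_of_mem_atlas (I := 𝓘(ℝ, BaseModel n)) hφ
  have e2 := mdifferentiable_of_mem_atlas (I := 𝓘(ℝ, BaseModel n)) hφ'
  have hc : mfderiv 𝓘(ℝ, BaseModel n) 𝓘(ℝ, BaseModel n) (φ' ∘ φ.symm) x =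
      (mfderiv 𝓘(ℝ, BaseModel n) 𝓘(ℝ, BaseModel n) φ' (φ.symm x)).comp
        (mfderiv 𝓘(ℝ, BaseModel n) 𝓘(ℝ, BaseModel n) φ.symm x) :=
    mfderiv_comp x (e2.mdifferentiableAt hx') (e1.mdifferentiableAt_symm hx)
  rw [mfderiv_eq_fderiv] at hc
  have h1 : ∀ v, (chartDeriv φ (φ.symm x)).symm v =
      mfderiv 𝓘(ℝ, BaseModel n) 𝓘(ℝ, BaseModel n) φ.symm x v := by
    intro v
    rw [chartDeriv_eq hφ (φ.map_target hx)]
    change mfderiv 𝓘(ℝ, BaseModel n) 𝓘(ℝ, BaseModel n) φ.symm (φ (φ.symm x)) v = _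
    rw [φ.right_inv hx]
  have h2 : ∀ v, chartDeriv φ' (φ.symm x) v =
      mfderiv 𝓘(ℝ, BaseModel n) 𝓘(ℝ, BaseModel n) φ' (φ.symm x) v := by
    intro v
    rw [chartDeriv_eq hφ' hx']
    rfl
  refine ContinuousLinearMap.ext fun z => ?_
  change Φ' (chartDeriv φ' (φ.symm x) ((chartDeriv φ (φ.symm x)).symm (Φ.symm z))) =
    Φ' (fderiv ℝ (φ' ∘ φ.symm) x (Φ.symm z))
  rw [h2, h1, hc]
  rfl

theorem mem_trans_source_iff {φ φ' : OpenPartialHomeomorph W (BaseModel n)}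
    (hφ : φ ∈ atlas (BaseModel n) W) (hφ' : φ' ∈ atlas (BaseModel n) W)
    (Φ Φ' : BaseModel n ≃L[ℝ] XSpace n × YSpace n) (z : JetModel n)
    (hz : z.1 ∈ φ.target) (hz' : φ.symm z.1 ∈ φ'.source) (B : XSpace n →L[ℝ] YSpace n) :
    IsGraphAt φ' Φ' (jetOfGraph φ Φ (φ.symm z.1) z.2) B ↔
      ((ContinuousLinearMap.fst ℝ _ _).comp ((transLin φ φ' Φ Φ' z.1).comp
        ((ContinuousLinearMap.id ℝ _).prod z.2))).IsInvertible ∧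
      B = ((ContinuousLinearMap.snd ℝ _ _).comp ((transLin φ φ' Φ Φ' z.1).comp
        ((ContinuousLinearMap.id ℝ _).prod z.2))).comp
        ((ContinuousLinearMap.fst ℝ _ _).comp ((transLin φ φ' Φ Φ' z.1).comp
        ((ContinuousLinearMap.id ℝ _).prod z.2))).inverse := by
  rw [← transLin_eq hφ hφ' Φ Φ' hz hz', ← map_graph_iff]
  have h : (jetOfGraph φ Φ (φ.symm z.1) z.2).plane =
      (z.2 : XSpace n →ₗ[ℝ] YSpace n).graph.map
        ((splitDeriv φ Φ (φ.symm z.1)).toLinearEquiv.symm :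
          _ →ₗ[ℝ] TangentSpace 𝓘(ℝ, BaseModel n) (φ.symm z.1)) :=
    Submodule.comap_equiv_eq_map_symm _ _
  unfold IsGraphAt
  rw [h]
  erw [← Submodule.map_comp]
  rfl

/-- The `ℝ^n`-component of the differential of a coordinate change on a graph. -/
def transFst (φ φ' : OpenPartialHomeomorph W (BaseModel n))
    (Φ Φ' : BaseModel n ≃L[ℝ] XSpace n × YSpace n) (z : JetModel n) : XSpace n →L[ℝ] XSpace n :=
  (ContinuousLinearMap.fst ℝ _ _).comp ((transLin φ φ' Φ Φ' z.1).comp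
    ((ContinuousLinearMap.id ℝ _).prod z.2))

/-- The `ℝ^{n+1}`-component of the differential of a coordinate change on a graph. -/
def transSnd (φ φ' : OpenPartialHomeomorph W (BaseModel n))
    (Φ Φ' : BaseModel n ≃L[ℝ] XSpace n × YSpace n) (z : JetModel n) : XSpace n →L[ℝ] YSpace n :=
  (ContinuousLinearMap.snd ℝ _ _).comp ((transLin φ φ' Φ Φ' z.1).comp
    ((ContinuousLinearMap.id ℝ _).prod z.2))

theorem trans_source_eq {φ φ' : OpenPartialHomeomorph W (BaseModel n)}
    (hφ : φ ∈ atlas (BaseModel n) W) (hφ' : φ' ∈ atlas (BaseModel n) W)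
    (Φ Φ' : BaseModel n ≃L[ℝ] XSpace n × YSpace n) :
    ((jetChart φ Φ).symm.trans (jetChart φ' Φ')).source =
      ((φ.symm.trans φ').source ×ˢ Set.univ) ∩
        transFst φ φ' Φ Φ' ⁻¹' {f | f.IsInvertible} := by
  ext z
  rw [PartialEquiv.trans_source]
  constructor
  · rintro ⟨⟨hz, -⟩, hz', B, hB⟩
    exact ⟨⟨⟨hz, hz'⟩, trivial⟩, ((mem_trans_source_iff hφ hφ' Φ Φ' z hz hz' B).1 hB).1⟩
  · rintro ⟨⟨⟨hz, hz'⟩, -⟩, h⟩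
    exact ⟨⟨hz, trivial⟩, hz', _, (mem_trans_source_iff hφ hφ' Φ Φ' z hz hz' _).2 ⟨h, rfl⟩⟩

theorem contDiffOn_transLin {φ φ' : OpenPartialHomeomorph W (BaseModel n)}
    (hφ : φ ∈ atlas (BaseModel n) W) (hφ' : φ' ∈ atlas (BaseModel n) W)
    (Φ Φ' : BaseModel n ≃L[ℝ] XSpace n × YSpace n) :
    ContDiffOn ℝ ∞ (φ' ∘ φ.symm) (φ.symm.trans φ').source ∧
    ContDiffOn ℝ ∞ (transLin φ φ' Φ Φ') (φ.symm.trans φ').source := by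
  have h0 : ContDiffOn ℝ ∞ (φ' ∘ φ.symm) (φ.symm.trans φ').source := by
    have := HasGroupoid.compatible (G := contDiffGroupoid ∞ 𝓘(ℝ, BaseModel n)) hφ hφ'
    rw [contDiffGroupoid, mem_groupoid_of_pregroupoid] at this
    simpa [contDiffPregroupoid] using this.1
  refine ⟨h0, contDiffOn_const.clm_comp ((h0.fderiv_of_isOpen
    (φ.symm.trans φ').open_source ?_).clm_comp contDiffOn_const)⟩
  norm_num

theorem contDiffOn_transFst {φ φ' : OpenPartialHomeomorph W (BaseModel n)}
    (hφ : φ ∈ atlas (BaseModel n) W) (hφ' : φ' ∈ atlas (BaseModel n) W)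
    (Φ Φ' : BaseModel n ≃L[ℝ] XSpace n × YSpace n) :
    ContDiffOn ℝ ∞ (transFst φ φ' Φ Φ') ((φ.symm.trans φ').source ×ˢ Set.univ) ∧
    ContDiffOn ℝ ∞ (transSnd φ φ' Φ Φ') ((φ.symm.trans φ').source ×ˢ Set.univ) := by
  have h1 : ContDiffOn ℝ ∞ (fun z : JetModel n => transLin φ φ' Φ Φ' z.1)
      ((φ.symm.trans φ').source ×ˢ Set.univ) :=
    (contDiffOn_transLin hφ hφ' Φ Φ').2.comp contDiff_fst.contDiffOn fun z hz => hz.1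
  have h2 : ContDiff ℝ ∞ (fun z : JetModel n =>
      (ContinuousLinearMap.id ℝ (XSpace n)).prod z.2) := by
    have : (fun z : JetModel n => (ContinuousLinearMap.id ℝ (XSpace n)).prod z.2) =
        fun z : JetModel n => (ContinuousLinearMap.inl ℝ (XSpace n) (YSpace n)) +
          (ContinuousLinearMap.inr ℝ (XSpace n) (YSpace n)).comp z.2 := by
      funext z
      ext1 v
      simp
    rw [this]
    exact contDiff_const.add (contDiff_const.clm_comp contDiff_snd)
  exact ⟨contDiffOn_const.clm_comp (h1.clm_comp h2.contDiffOn),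
    contDiffOn_const.clm_comp (h1.clm_comp h2.contDiffOn)⟩

theorem contDiffOn_trans {φ φ' : OpenPartialHomeomorph W (BaseModel n)}
    (hφ : φ ∈ atlas (BaseModel n) W) (hφ' : φ' ∈ atlas (BaseModel n) W)
    (Φ Φ' : BaseModel n ≃L[ℝ] XSpace n × YSpace n) :
    ContDiffOn ℝ ∞ ((jetChart φ Φ).symm.trans (jetChart φ' Φ'))
      ((jetChart φ Φ).symm.trans (jetChart φ' Φ')).source := by
  have hs := trans_source_eq hφ hφ' Φ Φ'
  obtain ⟨h1, h2⟩ := contDiffOn_transFst hφ hφ' Φ Φ'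
  have h3 : ContDiffOn ℝ ∞ (fun z : JetModel n => ((φ' ∘ φ.symm) z.1,
      (transSnd φ φ' Φ Φ' z).comp (transFst φ φ' Φ Φ' z).inverse))
      ((jetChart φ Φ).symm.trans (jetChart φ' Φ')).source := by
    rw [hs]
    refine ContDiffOn.prodMk ?_ ((h2.mono Set.inter_subset_left).clm_comp ?_)
    · exact (contDiffOn_transLin hφ hφ' Φ Φ').1.comp contDiff_fst.contDiffOn fun z hz => hz.1.1
    · intro z hz
      exact ContDiffAt.comp_contDiffWithinAt z
        (ContinuousLinearMap.IsInvertible.contDiffAt_map_inverse hz.2)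
        ((h1 z hz.1).mono Set.inter_subset_left)
  refine h3.congr fun z hz => ?_
  rw [hs] at hz
  obtain ⟨⟨⟨hz1, hz2⟩, -⟩, hz3⟩ := hz
  exact Prod.ext rfl (jetChart_snd ((mem_trans_source_iff hφ hφ' Φ Φ' z hz1 hz2 _).2 ⟨hz3, rfl⟩))

/-- Every plane is the graph of `0` for a suitable splitting. -/
theorem exists_splitting (φ : OpenPartialHomeomorph W (BaseModel n)) (q : Jet1 n W) :
    ∃ Φ : BaseModel n ≃L[ℝ] XSpace n × YSpace n, IsGraphAt φ Φ q 0 := by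
  let P : Submodule ℝ (BaseModel n) := q.plane.map ((chartDeriv φ q.base).toLinearEquiv :
    TangentSpace 𝓘(ℝ, BaseModel n) q.base →ₗ[ℝ] BaseModel n)
  have hP : Module.finrank ℝ P = n := by
    rw [LinearEquiv.finrank_map_eq, q.finrank_plane]
  obtain ⟨Q, hQ⟩ := P.exists_isCompl
  have hQ' : Module.finrank ℝ Q = n + 1 := by
    have := Submodule.finrank_add_eq_of_isCompl hQ
    rw [hP, finrank_euclideanSpace_fin] at this
    omega
  let e1 : P ≃ₗ[ℝ] XSpace n := LinearEquiv.ofFinrankEq _ _ (by rw [hP, finrank_euclideanSpace_fin])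
  let e2 : Q ≃ₗ[ℝ] YSpace n := LinearEquiv.ofFinrankEq _ _ (by rw [hQ', finrank_euclideanSpace_fin])
  let Φ : BaseModel n ≃ₗ[ℝ] XSpace n × YSpace n :=
    (Submodule.prodEquivOfIsCompl P Q hQ).symm.trans (e1.prodCongr e2)
  refine ⟨Φ.toContinuousLinearEquiv, ?_⟩
  have : P.map (Φ : BaseModel n →ₗ[ℝ] XSpace n × YSpace n) =
      (((0 : XSpace n →L[ℝ] YSpace n) : XSpace n →ₗ[ℝ] YSpace n)).graph := by
    ext z
    rw [LinearMap.mem_graph_iff]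
    constructor
    · rintro ⟨x, hx, rfl⟩
      have : (Submodule.prodEquivOfIsCompl P Q hQ).symm x = (⟨x, hx⟩, 0) :=
        Submodule.prodEquivOfIsCompl_symm_apply_left P Q hQ ⟨x, hx⟩
      simp [Φ, this]
    · intro hz
      refine ⟨(e1.symm z.1 : P), (e1.symm z.1).2, ?_⟩
      have : (Submodule.prodEquivOfIsCompl P Q hQ).symm (e1.symm z.1 : P) = (e1.symm z.1, 0) :=
        Submodule.prodEquivOfIsCompl_symm_apply_left P Q hQ _
      have hz' : z.2 = 0 := hz
      exact Prod.ext (by simp [Φ, this]) (by simp [Φ, this, hz'])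
  unfold IsGraphAt
  rw [← this, ← Submodule.map_comp]
  rfl

/-- The atlas of the local coordinates `(x^α, y^j, y^j_α)` on `J¹_n(W)`. -/
def jetCore (n : ℕ) (W : Type*) [TopologicalSpace W] [ChartedSpace (BaseModel n) W]
    [IsManifold 𝓘(ℝ, BaseModel n) ∞ W] : ChartedSpaceCore (JetModel n) (Jet1 n W) where
  atlas := {e | ∃ φ ∈ atlas (BaseModel n) W, ∃ Φ, e = jetChart φ Φ}
  chartAt q := jetChart (chartAt (BaseModel n) q.base)
    (exists_splitting (chartAt (BaseModel n) q.base) q).choose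
  mem_chart_source q := ⟨mem_chart_source _ _, 0,
    (exists_splitting (chartAt (BaseModel n) q.base) q).choose_spec⟩
  chart_mem_atlas q := ⟨_, chart_mem_atlas _ _, _, rfl⟩
  open_source := by
    rintro _ _ ⟨φ, hφ, Φ, rfl⟩ ⟨φ', hφ', Φ', rfl⟩
    rw [trans_source_eq hφ hφ']
    exact (contDiffOn_transFst hφ hφ' Φ Φ').1.continuousOn.isOpen_inter_preimage
      ((φ.symm.trans φ').open_source.prod isOpen_univ) ContinuousLinearEquiv.isOpen
  continuousOn_toFun := by
    rintro _ _ ⟨φ, hφ, Φ, rfl⟩ ⟨φ', hφ', Φ', rfl⟩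
    exact (contDiffOn_trans hφ hφ' Φ Φ').continuousOn

instance : TopologicalSpace (Jet1 n W) := (jetCore n W).toTopologicalSpace

instance : ChartedSpace (JetModel n) (Jet1 n W) := (jetCore n W).toChartedSpace

instance : IsManifold 𝓘(ℝ, JetModel n) ∞ (Jet1 n W) := by
  apply isManifold_of_contDiffOn
  intro e e' he he'
  obtain ⟨f, ⟨φ, hφ, Φ, rfl⟩, rfl⟩ : ∃ f, ∃ hf : f ∈ (jetCore n W).atlas,
      e = (jetCore n W).openPartialHomeomorph f hf := by
    obtain ⟨_, ⟨f, rfl⟩, _, ⟨hf, rfl⟩, h⟩ := he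
    exact ⟨f, hf, h⟩
  obtain ⟨f, ⟨φ', hφ', Φ', rfl⟩, rfl⟩ : ∃ f, ∃ hf : f ∈ (jetCore n W).atlas,
      e' = (jetCore n W).openPartialHomeomorph f hf := by
    obtain ⟨_, ⟨f, rfl⟩, _, ⟨hf, rfl⟩, h⟩ := he'
    exact ⟨f, hf, h⟩
  have h := contDiffOn_trans hφ hφ' Φ Φ'
  simp only [modelWithCornersSelf_coe, modelWithCornersSelf_coe_symm, Set.range_id, Set.inter_univ,
    Set.preimage_id_eq, id_eq, Function.comp_id, Function.id_comp]
  exact h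

end Charts

section Contact

variable {n : ℕ} {W : Type*} [TopologicalSpace W] [ChartedSpace (BaseModel n) W]

/-- The local expression of a `1`-form in a chart `φ`: its pullback by `φ⁻¹`. -/
def formInChart (χ : ∀ a : W, TangentSpace 𝓘(ℝ, BaseModel n) a →L[ℝ] ℝ)
    (φ : OpenPartialHomeomorph W (BaseModel n)) (x : BaseModel n) : BaseModel n →L[ℝ] ℝ :=
  (χ (φ.symm x)).comp (mfderiv 𝓘(ℝ, BaseModel n) 𝓘(ℝ, BaseModel n) φ.symm x)

/-- The exterior derivative `dθ` of a `1`-form `θ` on `ℝ^{2n+1}`, at `x`, on the vectors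
`u`, `v`. -/
def extDerivOneForm (θ : BaseModel n → BaseModel n →L[ℝ] ℝ) (x u v : BaseModel n) : ℝ :=
  fderiv ℝ θ x u v - fderiv ℝ θ x v u

/-- The value of `α ∧ β ∧ ⋯ ∧ β` (`n` factors `β`) on `2n+1` vectors, for a `1`-form `α` and a
`2`-form `β`, up to the positive factor by which conventions for the wedge product differ. -/
def wedgeTop (α : BaseModel n → ℝ) (β : BaseModel n → BaseModel n → ℝ)
    (v : Fin (2 * n + 1) → BaseModel n) : ℝ :=
  ∑ σ : Equiv.Perm (Fin (2 * n + 1)), ((Equiv.Perm.sign σ : ℤ) : ℝ) *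
    (α (v (σ 0)) * ∏ i : Fin n,
      β (v (σ ⟨2 * i + 1, by omega⟩)) (v (σ ⟨2 * i + 2, by omega⟩)))

/-- A contact structure on the `(2n+1)`-dimensional manifold `W`: a smooth `1`-form `χ` with
`χ ∧ (dχ)^n ≠ 0` at every point. -/
structure ContactForm (n : ℕ) (W : Type*) [TopologicalSpace W]
    [ChartedSpace (BaseModel n) W] where
  /-- the `1`-form -/
  form : ∀ a : W, TangentSpace 𝓘(ℝ, BaseModel n) a →L[ℝ] ℝ
  smooth : ∀ φ ∈ atlas (BaseModel n) W, ContDiffOn ℝ ∞ (formInChart form φ) φ.target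
  nondegenerate : ∀ φ ∈ atlas (BaseModel n) W, ∀ x ∈ φ.target,
    ∃ v, wedgeTop (formInChart form φ x) (extDerivOneForm (formInChart form φ) x) v ≠ 0

/-- The equation `Leg ⊂ J¹_n(W)` of Legendrian submanifolds: the `1`-jets of `n`-dimensional
submanifolds on which `χ` vanishes, `z_β - y_β = 0` where `χ = dz - y_α dx^α`. -/
def Leg (χ : ContactForm n W) : Set (Jet1 n W) :=
  {q | ∀ v ∈ q.plane, χ.form q.base v = 0}

end Contact

section Cartan

variable {n : ℕ} {W : Type*} [TopologicalSpace W] [ChartedSpace (BaseModel n) W]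
  [IsManifold 𝓘(ℝ, BaseModel n) ∞ W]

/-- `j` is, near `0`, the first prolongation `u ↦ [N]¹_{g(u)}` of an `n`-dimensional submanifold
`N` of `W` with local parametrization `g(u) = (j u).base`. Since the planes are `n`-dimensional,
the last condition makes `g` an immersion near `0`. -/
def IsProlongation (j : XSpace n → Jet1 n W) : Prop :=
  ∃ V : Set (XSpace n), IsOpen V ∧ 0 ∈ V ∧
    ContMDiffOn 𝓘(ℝ, XSpace n) 𝓘(ℝ, BaseModel n) ∞ (fun u => (j u).base) V ∧
    ∀ u ∈ V, (j u).plane = LinearMap.range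
      (mfderiv 𝓘(ℝ, XSpace n) 𝓘(ℝ, BaseModel n) (fun u => (j u).base) u).toLinearMap

/-- The Cartan distribution of `J¹_n(W)` at `q`: the span of the tangent spaces at `q` of the
first prolongations through `q` of `n`-dimensional submanifolds of `W`. -/
def cartan (q : Jet1 n W) : Submodule ℝ (TangentSpace 𝓘(ℝ, JetModel n) q) :=
  Submodule.span ℝ {ξ | ∃ j : XSpace n → Jet1 n W, IsProlongation j ∧
    ∃ v : TangentSpace 𝓘(ℝ, XSpace n) (0 : XSpace n),
      (⟨j 0, mfderiv 𝓘(ℝ, XSpace n) 𝓘(ℝ, JetModel n) j 0 v⟩ :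
        TangentBundle 𝓘(ℝ, JetModel n) (Jet1 n W)) = ⟨q, ξ⟩}

end Cartan

section Bar

universe u v w

variable {n : ℕ} {W : Type u} [TopologicalSpace W] [ChartedSpace (BaseModel n) W]
  [IsManifold 𝓘(ℝ, BaseModel n) ∞ W]

/-- `f : Δ^p → Leg` extends to a smooth map `F` into `Leg` of a neighbourhood of `Δ^p` in
`ℝ^{p+1}`, and the tangent map of `f` sends `T Δ^p` into the Cartan distribution. The tangent
vectors of `Δ^p` are the vectors with sum of coordinates zero. -/
def IsBar (χ : ContactForm n W) {p : ℕ} (f : stdSimplex ℝ (Fin (p + 1)) → Leg χ) : Prop :=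
  ∃ (U : Set (Fin (p + 1) → ℝ)) (F : (Fin (p + 1) → ℝ) → Jet1 n W),
    IsOpen U ∧ stdSimplex ℝ (Fin (p + 1)) ⊆ U ∧
    ContMDiffOn 𝓘(ℝ, Fin (p + 1) → ℝ) 𝓘(ℝ, JetModel n) ∞ F U ∧
    (∀ x ∈ U, F x ∈ Leg χ) ∧
    (∀ x : stdSimplex ℝ (Fin (p + 1)), F x = f x) ∧
    ∀ x ∈ stdSimplex ℝ (Fin (p + 1)), ∀ v : Fin (p + 1) → ℝ, ∑ i, v i = 0 →
      mfderiv 𝓘(ℝ, Fin (p + 1) → ℝ) 𝓘(ℝ, JetModel n) F x v ∈ cartan (F x)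

/-- The bar singular `p`-simplices of `Leg`. -/
def BarSimplex (χ : ContactForm n W) (p : ℕ) : Type u :=
  {f : stdSimplex ℝ (Fin (p + 1)) → Leg χ // IsBar χ f}

/-- A bar simplex composed with the affine map of simplices given by a map of vertices. -/
def BarSimplex.pull {χ : ContactForm n W} {p r : ℕ} (θ : Fin (r + 1) → Fin (p + 1))
    (f : BarSimplex χ p) : BarSimplex χ r :=
  ⟨fun x => f.1 (stdSimplex.map θ x), by
    obtain ⟨U, F, hU, hsub, hF, hLeg, hf, hcar⟩ := f.2
    let ℓ : (Fin (r + 1) → ℝ) →L[ℝ] (Fin (p + 1) → ℝ) :=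
      (FunOnFinite.linearMap ℝ ℝ θ).toContinuousLinearMap
    have hℓ : ∀ x ∈ stdSimplex ℝ (Fin (r + 1)), ℓ x ∈ stdSimplex ℝ (Fin (p + 1)) :=
      fun x hx => stdSimplex.image_linearMap θ ⟨x, hx, rfl⟩
    have hsm : ContMDiff 𝓘(ℝ, Fin (r + 1) → ℝ) 𝓘(ℝ, Fin (p + 1) → ℝ) ∞ ℓ :=
      ℓ.contDiff.contMDiff
    refine ⟨ℓ ⁻¹' U, F ∘ ℓ, hU.preimage ℓ.continuous, fun x hx => hsub (hℓ x hx),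
      hF.comp hsm.contMDiffOn fun x hx => hx, fun x hx => hLeg _ hx,
      fun x => hf (stdSimplex.map θ x), fun x hx v hv => ?_⟩
    have h1 : MDifferentiableAt 𝓘(ℝ, Fin (p + 1) → ℝ) 𝓘(ℝ, JetModel n) F (ℓ x) :=
      ((hF _ (hsub (hℓ x hx))).contMDiffAt (hU.mem_nhds (hsub (hℓ x hx)))).mdifferentiableAt
        (by simp)
    have h2 : MDifferentiableAt 𝓘(ℝ, Fin (r + 1) → ℝ) 𝓘(ℝ, Fin (p + 1) → ℝ) ℓ x :=
      hsm.mdifferentiableAt (by simp)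
    rw [mfderiv_comp x h1 h2, mfderiv_eq_fderiv, ContinuousLinearMap.fderiv]
    refine hcar _ (hℓ x hx) (ℓ v) ?_
    rw [← hv]
    change ∑ i, FunOnFinite.linearMap ℝ ℝ θ v i = _
    simp only [FunOnFinite.linearMap_apply_apply]
    exact Finset.sum_fiberwise Finset.univ θ v⟩

theorem BarSimplex.pull_id {χ : ContactForm n W} {p : ℕ} (f : BarSimplex χ p) :
    f.pull id = f := by
  refine Subtype.ext (funext fun x => ?_)
  simp only [BarSimplex.pull, stdSimplex.map_id_apply]

theorem BarSimplex.pull_pull {χ : ContactForm n W} {p r s : ℕ} (f : BarSimplex χ p)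
    (θ : Fin (r + 1) → Fin (p + 1)) (η : Fin (s + 1) → Fin (r + 1)) :
    (f.pull θ).pull η = f.pull (θ ∘ η) := by
  refine Subtype.ext (funext fun x => ?_)
  simp only [BarSimplex.pull, stdSimplex.map_comp_apply]

variable (R : Type w) [Ring R] (G : Type v) [AddCommGroup G] [Module R G]

/-- The simplicial module of formal linear combinations, with coefficients in `G`, of bar singular
simplices. -/
def barSimplicial (χ : ContactForm n W) : SimplicialObject (ModuleCat.{max u v} R) where
  obj Δ := ModuleCat.of R (BarSimplex χ Δ.unop.len →₀ G)
  map θ := ModuleCat.ofHom (Finsupp.lmapDomain G R (BarSimplex.pull θ.unop.toOrderHom))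
  map_id Δ := by
    have h : BarSimplex.pull (χ := χ) (𝟙 Δ : Δ ⟶ Δ).unop.toOrderHom = id :=
      funext fun f => f.pull_id
    rw [h, Finsupp.lmapDomain_id]
    rfl
  map_comp θ η := by
    have h0 : ⇑(θ ≫ η).unop.toOrderHom = ⇑θ.unop.toOrderHom ∘ ⇑η.unop.toOrderHom := rfl
    have h : BarSimplex.pull (χ := χ) (⇑θ.unop.toOrderHom ∘ ⇑η.unop.toOrderHom) =
        BarSimplex.pull ⇑η.unop.toOrderHom ∘ BarSimplex.pull ⇑θ.unop.toOrderHom := by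
      funext f
      rw [Function.comp_apply, BarSimplex.pull_pull]
    rw [h0, h, Finsupp.lmapDomain_comp]
    rfl

/-- The bar singular chain complex `C̄_•(Leg; G)`, with `∂ = ∑ᵢ (-1)ⁱ dᵢ`. -/
def barComplex (χ : ContactForm n W) : ChainComplex (ModuleCat.{max u v} R) ℕ :=
  (AlgebraicTopology.alternatingFaceMapComplex (ModuleCat.{max u v} R)).obj (barSimplicial R G χ)

/-- The bar singular homology `H̄_p(Leg; G)`. -/
abbrev barHomology (χ : ContactForm n W) (p : ℕ) : ModuleCat.{max u v} R :=
  (barComplex R G χ).homology p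

/-- The boundaries `B̄_p(Leg; G)`. -/
def barB (χ : ContactForm n W) (p : ℕ) : Submodule R ((barComplex R G χ).X p) :=
  LinearMap.range ((barComplex R G χ).d (p + 1) p).hom

/-- The cycles `Z̄_p(Leg; G)`. All `0`-chains are cycles. -/
def barZ (χ : ContactForm n W) (p : ℕ) : Submodule R ((barComplex R G χ).X p) :=
  LinearMap.ker ((barComplex R G χ).d p ((ComplexShape.down ℕ).next p)).hom

/-- The bordism group `Bor_p(Leg; G)`: `p`-chains, where `a` and `b` are identified if
`a - b = ∂ c` for some chain `c`. -/
abbrev Bor (χ : ContactForm n W) (p : ℕ) : Type (max u v) :=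
  (barComplex R G χ).X p ⧸ barB R G χ p

/-- The cyclism group `Cyc_p(Leg; G)`: `p`-chains, where `a` and `b` are identified if
`∂ (a - b) = 0`. -/
abbrev Cyc (χ : ContactForm n W) (p : ℕ) : Type (max u v) :=
  (barComplex R G χ).X p ⧸ barZ R G χ p

/-- The `G`-singular Legendrian (closed) bordism group: closed `p`-chains, where `a` and `b` are
identified if `a - b = ∂ c` for some chain `c`. -/
abbrev Omega (χ : ContactForm n W) (p : ℕ) : Type (max u v) :=
  barZ R G χ p ⧸ (barB R G χ p).comap (barZ R G χ p).subtype

end Bar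

end LegBordism

end

/-! The content is the homological algebra of a chain module `C` with its boundaries `B` and cycles
`Z`. Since the boundary operator squares to zero (`barB_le_barZ`), `B ≤ Z ≤ C`, and the third
isomorphism theorem gives the exact sequence `0 → Z/B → C/B → C/Z → 0`, whose terms are the closed
bordism group, `Bor` and `Cyc`. All three claims are read off from it.

The left-hand term `Z/B` is homology in its elementary description. Abstract homology is the
cokernel of the map from chains to an abstract object of cycles, itself a kernel of the
differential; `exists_kerQuotientRange_equiv_homology` identifies these with the submodules `Z` and
`B`, keeping track of representatives. If `Z/B` vanishes, then `B = Z` and the two remaining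
quotients coincide (`exists_quotient_equiv_of_subsingleton`). If `C/Z` is free, it is projective, so
the surjection onto it has a linear section and the sequence splits
(`exists_quotient_equiv_prod_of_projective`). -/

/-! ### Homology of a complex of modules as cycles modulo boundaries. -/

open CategoryTheory in
/-- The image of the cycles of a complex of modules in the chains is the kernel of the
differential. -/
theorem HomologicalComplex.range_iCycles_hom {R ι : Type*} [Ring R] {c : ComplexShape ι}
    (K : HomologicalComplex (ModuleCat R) c) {i j : ι} (hj : c.next i = j) :
    LinearMap.range (K.iCycles i).hom = LinearMap.ker (K.d i j).hom :=
  (ShortComplex.exact_of_f_is_kernel (.mk _ _ (K.iCycles_d i j))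
    (K.cyclesIsKernel i j hj)).moduleCat_range_eq_ker

open CategoryTheory in
/-- A cycle is homologous to zero iff it is a boundary. -/
theorem HomologicalComplex.ker_homologyπ_hom {R ι : Type*} [Ring R] {c : ComplexShape ι}
    (K : HomologicalComplex (ModuleCat R) c) {i j : ι} (hi : c.prev j = i) :
    LinearMap.ker (K.homologyπ j).hom =
      (LinearMap.range (K.d i j).hom).comap (K.iCycles j).hom := by
  have hinj : Function.Injective (K.iCycles j).hom :=
    (ModuleCat.mono_iff_injective _).1 inferInstance
  have hex := (ShortComplex.exact_of_g_is_cokernel (.mk _ _ (K.toCycles_comp_homologyπ i j))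
    (K.homologyIsCokernel i j hi)).moduleCat_range_eq_ker
  -- The differential factors through the cycles, and the inclusion of cycles is injective, so
  -- pulling the boundaries back along it leaves exactly the range of `toCycles`. By `hex` this is
  -- the kernel of the projection to homology.
  rw [← K.toCycles_i i j, ModuleCat.hom_comp, LinearMap.range_comp,
    Submodule.comap_map_eq_of_injective hinj]
  exact hex.symm

open CategoryTheory in
/-- The homology of a complex of modules is the quotient of the kernel of the outgoing
differential by the image of the incoming one. -/
theorem HomologicalComplex.exists_kerQuotientRange_equiv_homology {R ι : Type*} [Ring R]
    {c : ComplexShape ι} (K : HomologicalComplex (ModuleCat R) c) {i j k : ι}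
    (hi : c.prev j = i) (hk : c.next j = k) :
    ∃ e : (LinearMap.ker (K.d j k).hom ⧸ (LinearMap.range (K.d i j).hom).comap
        (LinearMap.ker (K.d j k).hom).subtype) ≃ₗ[R] K.homology j,
      ∀ (x : K.cycles j) (z : LinearMap.ker (K.d j k).hom),
        K.iCycles j x = z → e (Submodule.Quotient.mk z) = K.homologyπ j x := by
  have hinj : Function.Injective (K.iCycles j).hom :=
    (ModuleCat.mono_iff_injective _).1 inferInstance
  have hsurj : Function.Surjective (K.homologyπ j).hom :=
    (ModuleCat.epi_iff_surjective _).1 inferInstance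
  -- The abstract cycles are carried to the concrete kernel by the inclusion itself, so `E` does not
  -- change the underlying chain.
  let E : K.cycles j ≃ₗ[R] LinearMap.ker (K.d j k).hom :=
    (LinearEquiv.ofInjective _ hinj).trans (LinearEquiv.ofEq _ _ (K.range_iCycles_hom hk))
  have hE : ∀ x, (E x : K.X j) = (K.iCycles j).hom x := fun _ => rfl
  -- `F` takes a concrete cycle to its homology class. It is onto with the boundaries as kernel, so
  -- the first isomorphism theorem yields `e`.
  let F : LinearMap.ker (K.d j k).hom →ₗ[R] K.homology j := (K.homologyπ j).hom ∘ₗ E.symm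
  have hF : LinearMap.ker F =
      (LinearMap.range (K.d i j).hom).comap (LinearMap.ker (K.d j k).hom).subtype := by
    ext z
    obtain ⟨x, rfl⟩ := E.surjective z
    have h := SetLike.ext_iff.1 (K.ker_homologyπ_hom hi) x
    rw [LinearMap.mem_ker, Submodule.mem_comap] at h ⊢
    rw [Submodule.subtype_apply, hE, ← h]
    simp [F]
  refine ⟨(Submodule.quotEquivOfEq _ _ hF.symm).trans
    (F.quotKerEquivOfSurjective (hsurj.comp E.symm.surjective)), fun x z hxz => ?_⟩
  obtain rfl : E x = z := Subtype.ext hxz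
  change F (E x) = _
  simp [F]

/-! ### Quotients by nested submodules. -/

namespace Submodule

variable {R M : Type*} [Ring R] [AddCommGroup M] [Module R M] {B Z : Submodule R M}

/-- If `B ≤ Z` and `Z ⧸ B` is trivial, the projection `M ⧸ B → M ⧸ Z` is an isomorphism. -/
theorem exists_quotient_equiv_of_subsingleton (h : B ≤ Z)
    [Subsingleton (Z ⧸ B.comap Z.subtype)] :
    ∃ e : (M ⧸ B) ≃ₗ[R] M ⧸ Z, ∀ a : M, e (Quotient.mk a) = Quotient.mk a := by
  -- A trivial `Z ⧸ B` means that `B` pulled back to `Z` is everything.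
  have hZ : Z ≤ B := comap_subtype_eq_top.1 (Submodule.Quotient.subsingleton_iff.1 ‹_›)
  exact ⟨quotEquivOfEq _ _ (le_antisymm h hZ), fun _ => rfl⟩

/-- If `B ≤ Z` and `M ⧸ Z` is projective, the extension `M ⧸ B` of `M ⧸ Z` by `Z ⧸ B` splits. -/
theorem exists_quotient_equiv_prod_of_projective (h : B ≤ Z) [Module.Projective R (M ⧸ Z)] :
    ∃ e : (M ⧸ B) ≃ₗ[R] (Z ⧸ B.comap Z.subtype) × (M ⧸ Z),
      (∀ z : Z, e (Quotient.mk (z : M)) = (Quotient.mk z, 0)) ∧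
      ∀ a : M, (e (Quotient.mk a)).2 = Quotient.mk a := by
  -- `f` and `g` are the two maps of the short exact sequence `0 → Z/B → M/B → M/Z → 0`.
  let f : (Z ⧸ B.comap Z.subtype) →ₗ[R] M ⧸ B := mapQ _ _ Z.subtype le_rfl
  let g : (M ⧸ B) →ₗ[R] M ⧸ Z := factor h
  have hf : Function.Injective f := by
    rw [← LinearMap.ker_eq_bot, ker_mapQ]
    exact mkQ_map_self _
  have hg : Function.Surjective g := factor_surjective h
  have hfg : Function.Exact f g := by
    intro x
    obtain ⟨a, rfl⟩ := Quotient.mk_surjective _ x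
    constructor
    · intro ha
      exact ⟨Quotient.mk ⟨a, (Quotient.mk_eq_zero Z).1 ha⟩, rfl⟩
    · rintro ⟨y, hy⟩
      obtain ⟨z, rfl⟩ := Quotient.mk_surjective _ y
      rw [← hy]
      exact (Quotient.mk_eq_zero Z).2 z.2
  -- Lifting the identity of `M ⧸ Z` through `g` gives the section that splits the sequence.
  obtain ⟨s, hs⟩ := Module.projective_lifting_property g LinearMap.id hg
  obtain ⟨e, he, he'⟩ := hfg.splitSurjectiveEquiv hf ⟨s, hs⟩
  -- The splitting turns `f` into the inclusion of the first factor (`he`) and `g` into the second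
  -- projection (`he'`); evaluated on representatives, these are the two required formulas.
  refine ⟨e, fun z => ?_, fun a => (LinearMap.congr_fun he' (Quotient.mk a)).symm⟩
  have := LinearMap.congr_fun he (Quotient.mk z)
  exact (e.symm_apply_eq.1 this.symm).symm

end Submodule

/-! ### The bar complex of the Legendrian equation. -/

namespace LegBordism

open CategoryTheory
open scoped Manifold ContDiff

theorem barB_le_barZ {n : ℕ} {W : Type*} [TopologicalSpace W] [ChartedSpace (BaseModel n) W]
    [IsManifold 𝓘(ℝ, BaseModel n) ∞ W] (χ : ContactForm n W)
    (R : Type*) [Ring R] (G : Type*) [AddCommGroup G] [Module R G] (p : ℕ) :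
    barB R G χ p ≤ barZ R G χ p :=
  LinearMap.range_le_ker_iff.2 (by rw [← ModuleCat.hom_comp, HomologicalComplex.d_comp_d]; rfl)

end LegBordism

/-- Each equivalence comes with its effect on representatives, which is what makes it canonical or
compatible with the exact sequence, not merely an abstract isomorphism. In the last claim the two
formulas say that `e` matches the inclusion of closed classes with the first factor and the
projection to `Cyc` with the second. -/
theorem theoremB {n : ℕ} {W : Type*} [TopologicalSpace W] [T2Space W] [SecondCountableTopology W]
    [ChartedSpace (LegBordism.BaseModel n) W]
    [IsManifold 𝓘(ℝ, LegBordism.BaseModel n) ∞ W] (χ : LegBordism.ContactForm n W)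
    (R : Type*) [Ring R] (G : Type*) [AddCommGroup G] [Module R G] (p : ℕ) :
    (∃ e : LegBordism.Omega R G χ p ≃ₗ[R] LegBordism.barHomology R G χ p,
      ∀ (c : (LegBordism.barComplex R G χ).cycles p) (z : LegBordism.barZ R G χ p),
        (LegBordism.barComplex R G χ).iCycles p c = z →
          e (Submodule.Quotient.mk z) = (LegBordism.barComplex R G χ).homologyπ p c) ∧
    (Subsingleton (LegBordism.Omega R G χ p) →
      ∃ e : LegBordism.Bor R G χ p ≃ₗ[R] LegBordism.Cyc R G χ p,
        ∀ a, e (Submodule.Quotient.mk a) = Submodule.Quotient.mk a) ∧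
    (Module.Free R (LegBordism.Cyc R G χ p) →
      ∃ e : LegBordism.Bor R G χ p ≃ₗ[R] LegBordism.Omega R G χ p × LegBordism.Cyc R G χ p,
        (∀ z : LegBordism.barZ R G χ p,
          e (Submodule.Quotient.mk (z : (LegBordism.barComplex R G χ).X p)) =
            (Submodule.Quotient.mk z, 0)) ∧
        ∀ a, (e (Submodule.Quotient.mk a)).2 = Submodule.Quotient.mk a) := by
  -- The degree before `p` is `p + 1`, as in `barB`; the degree after it is left as `next p`, as in
  -- `barZ`. This covers `p = 0` uniformly: there `next 0 = 0` by default and the differential from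
  -- degree `0` to itself is zero.
  refine ⟨HomologicalComplex.exists_kerQuotientRange_equiv_homology _
    (ChainComplex.prev ℕ p) rfl, fun _ => ?_, fun _ => ?_⟩
  · exact Submodule.exists_quotient_equiv_of_subsingleton (LegBordism.barB_le_barZ χ R G p)
  -- Projectivity of `Cyc` is inferred from its freeness.
  · exact Submodule.exists_quotient_equiv_prod_of_projective (LegBordism.barB_le_barZ χ R G p)
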